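/- A *Cantor space* is a compact metrizable space which is zero-dimensional (the clopen sets form a basis) and perfect (there are no isolated points). A *Cantor measure space* $(X,\mu)$ is a Cantor space $X$ with a finite Borel measure $\mu$, $\mu(X)>0$, which is full (every nonempty open set has positive measure) and nonatomic. It is *good* if for all clopen $A,B\subset X$ with $\mu(A)\le\mu(B)$ there is a clopen $A_1\subset B$ with $\mu(A_1)=\mu(A)$. Its *clopen values set* is $S(\mu)=\{\mu(A): A\subset X \text{ clopen}\}$. A *Cantor measure space map* $f:(X,\mu)\to(Y,\nu)$ is a continuous map $f : X\to Y$ with $\mu(f^{-1}(B))=\nu(B)$ for every Borel set $B\subset Y$; it is an *isomorphism* if there is a Cantor measure space map $g:(Y,\nu)\to(X,\mu)$ such that $g\circ f=\mathrm{id}_X$ $\mu$-almost everywhere and $f\circ g=\mathrm{id}_Y$ $\nu$-almost everywhere. The set of Cantor measure space maps from $(X,\mu)$ to $(Y,\nu)$ carries the topology of uniform convergence. **Theorem.** Let $(X,\mu)$ and $(Y,\nu)$ be good Cantor measure spaces with $S(\mu)=S(\nu)$. Then the space of Cantor measure space maps from $(X,\mu)$ to $(Y,\nu)$ is completely metrizable,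 and the isomorphisms form a dense $G_\delta$ subset of it. Thus the generic Cantor measure space map from $(X,\mu)$ to $(Y,\nu)$ is invertible: the set of those maps which are isomorphisms, and homeomorphisms from $X$ onto $Y$, is residual (it contains a dense $G_\delta$ set). -/

import Mathlib

open Set TopologicalSpace MeasureTheory Topology

/-- A Cantor space: compact, metrizable, zero-dimensional (the clopen sets form a basis), and
perfect (no isolated points). -/
structure IsCantorSpace (X : Type*) [TopologicalSpace X] : Prop where
  compact : CompactSpace X
  metrizable : MetrizableSpace X
  clopen_basis : IsTopologicalBasis {U : Set X | IsClopen U}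
  not_isolated : ∀ x : X, ¬ IsOpen ({x} : Set X)

/-- `A` is an atom of `μ`: a measurable set of positive measure each of whose measurable subsets
has either full measure in `A` or measure zero. -/
def IsMeasureAtom {X : Type*} [MeasurableSpace X] (μ : Measure X) (A : Set X) : Prop :=
  MeasurableSet A ∧ 0 < μ A ∧
    ∀ B : Set X, MeasurableSet B → B ⊆ A → μ B = μ A ∨ μ B = 0

/-- A Cantor measure space: a Cantor space with a (nonzero) finite Borel measure which is full
(nonempty open sets have positive measure) and nonatomic (it has no atoms). -/
structure IsCantorMeasureSpace (X : Type*) [TopologicalSpace X] [MeasurableSpace X]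
    (μ : Measure X) : Prop where
  cantor : IsCantorSpace X
  borel : BorelSpace X
  measure_univ_pos : 0 < μ univ
  measure_univ_lt_top : μ univ < ⊤
  full : ∀ U : Set X, IsOpen U → U.Nonempty → 0 < μ U
  nonatomic : ∀ A : Set X, ¬ IsMeasureAtom μ A

/-- A good Cantor measure space: a Cantor measure space satisfying the subset condition. -/
structure IsGoodCantorMeasureSpace (X : Type*) [TopologicalSpace X] [MeasurableSpace X]
    (μ : Measure X) : Prop extends IsCantorMeasureSpace X μ where
  subset_condition : ∀ A B : Set X, IsClopen A → IsClopen B → μ A ≤ μ B →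
    ∃ A₁ : Set X, IsClopen A₁ ∧ A₁ ⊆ B ∧ μ A₁ = μ A

/-- The clopen values set `S(μ)`. For a finite measure its members are finite, so that it makes no
difference whether they are taken as real or as extended nonnegative numbers. -/
def clopenValues {X : Type*} [TopologicalSpace X] [MeasurableSpace X] (μ : Measure X) :
    Set ENNReal :=
  {t | ∃ A : Set X, IsClopen A ∧ μ A = t}

/-- The space of Cantor measure space maps, that is, of continuous measure-preserving maps.
It is a subspace of `C(X, Y)`, whose topology is the compact-open topology: for compact `X` and
metrizable `Y` this is the topology of uniform convergence. -/
abbrev CantorMeasureMap {X Y : Type*} [TopologicalSpace X] [MeasurableSpace X]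
    [TopologicalSpace Y] [MeasurableSpace Y] (μ : Measure X) (ν : Measure Y) : Type _ :=
  {f : C(X, Y) // MeasurePreserving f μ ν}

/-- A Cantor measure space map is an isomorphism if it has an inverse which is a Cantor measure
space map, the compositions being the identity almost everywhere. -/
def CantorMeasureMap.IsIsomorphism {X Y : Type*} [TopologicalSpace X] [MeasurableSpace X]
    [TopologicalSpace Y] [MeasurableSpace Y] {μ : Measure X} {ν : Measure Y}
    (f : CantorMeasureMap μ ν) : Prop :=
  ∃ g : CantorMeasureMap ν μ,
    (∀ᵐ x ∂μ, g.1 (f.1 x) = x) ∧ (∀ᵐ y ∂ν, f.1 (g.1 y) = y)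

/-! Because the measures are full, a Cantor measure space map is an isomorphism exactly when it is
injective, and it is then a homeomorphism. Injectivity means that `f '' A` and `f '' Aᶜ` are
disjoint for each of the countably many clopen `A`. Each such condition is open, and the
measure-preserving maps are closed in the complete space `C(X, Y)`, so by Baire it remains to prove
each condition dense (`dense_setOf_disjoint_image`).

Given `f`, partition `Y` into small clopen cells and pull the partition back along `f`. Goodness of
`ν` allows each cell of `Y` to be split as `A` splits its preimage. Goodness of `μ` then yields a
map `g` respecting the split partitions (`exists_map_of_matched`): it is close to `f` and separates
`A` from `Aᶜ`. -/

theorem TopologicalSpace.IsTopologicalBasis.countable_clopens {X : Type*} [TopologicalSpace X]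
    [CompactSpace X] [MetrizableSpace X] (hX : IsTopologicalBasis {U : Set X | IsClopen U}) :
    Countable (Clopens X) := by
  have := totallySeparatedSpace_of_t0_of_basis_clopen hX
  exact Clopens.countable_iff_secondCountable.2 inferInstance

theorem IsCantorMeasureSpace.measurePreserving_of_clopen {X Y : Type*} [TopologicalSpace X]
    [MeasurableSpace X] [TopologicalSpace Y] [MeasurableSpace Y] {μ : Measure X} {ν : Measure Y}
    (hμ : IsCantorMeasureSpace X μ) (hν : IsCantorMeasureSpace Y ν) {f : X → Y}
    (hf : Continuous f) (h : ∀ B : Set Y, IsClopen B → μ (f ⁻¹' B) = ν B) :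
    MeasurePreserving f μ ν := by
  have := hμ.borel
  have := hν.borel
  have := hν.cantor.compact
  have := hν.cantor.metrizable
  have : IsFiniteMeasure μ := ⟨hμ.measure_univ_lt_top⟩
  refine ⟨hf.measurable, ?_⟩
  refine ext_of_generate_finite {U : Set Y | IsClopen U}
    (hν.borel.measurable_eq.trans hν.cantor.clopen_basis.borel_eq_generateFrom)
    (fun s hs t ht _ => hs.inter ht) (fun s hs => ?_) ?_
  · rw [Measure.map_apply hf.measurable hs.isOpen.measurableSet, h s hs]
  · rw [Measure.map_apply hf.measurable MeasurableSet.univ, h _ isClopen_univ]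

/-! ### Clopen partitions as labellings, and maps built from them. -/

/-- Two labellings by natural numbers have matching label classes of equal measure. -/
def MeasureMatched {X Y : Type*} [MeasurableSpace X] [MeasurableSpace Y] (μ : Measure X)
    (ν : Measure Y) (p : X → ℕ) (q : Y → ℕ) : Prop :=
  ∀ k, μ (p ⁻¹' {k}) = ν (q ⁻¹' {k})

theorem MeasureMatched.preimage_eq {X Y : Type*} [TopologicalSpace X]
    [MeasurableSpace X] [BorelSpace X] [TopologicalSpace Y] [MeasurableSpace Y] [BorelSpace Y]
    {μ : Measure X} {ν : Measure Y} {p : X → ℕ} {q : Y → ℕ} (h : MeasureMatched μ ν p q)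
    (hp : Continuous p) (hq : Continuous q) (S : Set ℕ) :
    μ (p ⁻¹' S) = ν (q ⁻¹' S) := by
  have : μ.map p = ν.map q := by
    refine Measure.ext_of_singleton fun k => ?_
    rw [Measure.map_apply hp.measurable (measurableSet_singleton k),
      Measure.map_apply hq.measurable (measurableSet_singleton k), h k]
  rw [← Measure.map_apply hp.measurable (MeasurableSet.of_discrete),
    ← Measure.map_apply hq.measurable (MeasurableSet.of_discrete), this]

open Classical in
/-- The labelling obtained from `q` by appending the binary digit telling membership in `B`. -/
noncomputable def refineLabel {Y : Type*} (q : Y → ℕ) (B : Set Y) (y : Y) : ℕ :=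
  2 * q y + if y ∈ B then 1 else 0

theorem refineLabel_div {Y : Type*} (q : Y → ℕ) (B : Set Y) (y : Y) :
    refineLabel q B y / 2 = q y := by
  unfold refineLabel; split_ifs <;> omega

theorem refineLabel_mod {Y : Type*} (q : Y → ℕ) (B : Set Y) (y : Y) :
    refineLabel q B y % 2 = 1 ↔ y ∈ B := by
  unfold refineLabel; split_ifs with h <;> simp [h]

open Classical in
theorem continuous_refineLabel {Y : Type*} [TopologicalSpace Y] {q : Y → ℕ} (hq : Continuous q)
    {B : Set Y} (hB : IsClopen B) : Continuous (refineLabel q B) := by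
  have : Continuous fun y => (q y, if y ∈ B then 1 else 0) :=
    hq.prodMk (continuous_const.if (by simp [hB.frontier_eq]) continuous_const)
  exact (continuous_of_discreteTopology (f := fun z : ℕ × ℕ => 2 * z.1 + z.2)).comp this

theorem preimage_refineLabel_odd {Y : Type*} (q : Y → ℕ) (B : Set Y) (k : ℕ) :
    refineLabel q B ⁻¹' {2 * k + 1} = q ⁻¹' {k} ∩ B := by
  ext y
  simp only [mem_preimage, mem_singleton_iff, mem_inter_iff, refineLabel]
  split_ifs with h <;> simp [h]
  omega

theorem preimage_refineLabel_even {Y : Type*} (q : Y → ℕ) (B : Set Y) (k : ℕ) :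
    refineLabel q B ⁻¹' {2 * k} = q ⁻¹' {k} \ B := by
  ext y
  simp only [mem_preimage, mem_singleton_iff, mem_sdiff, refineLabel]
  split_ifs with h <;> simp [h]
  omega

/-- A clopen refinement of a labelling of `Y` can be copied to a matched labelling of `X`. -/
theorem IsGoodCantorMeasureSpace.exists_refineLabel {X Y : Type*} [TopologicalSpace X]
    [MeasurableSpace X] [TopologicalSpace Y] [MeasurableSpace Y] {μ : Measure X} {ν : Measure Y}
    (hμ : IsGoodCantorMeasureSpace X μ) (hν : IsGoodCantorMeasureSpace Y ν)
    (hS : clopenValues ν ⊆ clopenValues μ) {p : X → ℕ} {q : Y → ℕ} (hp : Continuous p)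
    (hq : Continuous q) (h : MeasureMatched μ ν p q) {B : Set Y} (hB : IsClopen B) :
    ∃ A : Set X, IsClopen A ∧ MeasureMatched μ ν (refineLabel p A) (refineLabel q B) := by
  have := hμ.borel
  have := hν.borel
  have : IsFiniteMeasure μ := ⟨hμ.measure_univ_lt_top⟩
  have : IsFiniteMeasure ν := ⟨hν.measure_univ_lt_top⟩
  have hpk (k : ℕ) : IsClopen (p ⁻¹' {k}) := (isClopen_discrete {k}).preimage hp
  have hqk (k : ℕ) : IsClopen (q ⁻¹' {k}) := (isClopen_discrete {k}).preimage hq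
  -- The value to be copied is a clopen value of `μ` by `hS`; the subset condition moves a set
  -- realizing it into the cell of `p`.
  have key (k : ℕ) : ∃ A : Set X, IsClopen A ∧ A ⊆ p ⁻¹' {k} ∧ μ A = ν (q ⁻¹' {k} ∩ B) := by
    obtain ⟨A, hA, hAm⟩ := hS ⟨_, (hqk k).inter hB, rfl⟩
    obtain ⟨A₁, h₁, h₂, h₃⟩ := hμ.subset_condition A _ hA (hpk k)
      (by rw [hAm, h k]; exact measure_mono inter_subset_left)
    exact ⟨A₁, h₁, h₂, h₃.trans hAm⟩
  choose A hA hAp hAm using key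
  have hopen : ∀ C : ℕ → Set X, (∀ k, IsOpen (C k)) → IsOpen (⋃ k, p ⁻¹' {k} ∩ C k) :=
    fun C hC => isOpen_iUnion fun k => (hpk k).isOpen.inter (hC k)
  have hinter (k : ℕ) : p ⁻¹' {k} ∩ (⋃ k, p ⁻¹' {k} ∩ A k) = A k := by
    ext x
    simp only [mem_inter_iff, mem_preimage, mem_singleton_iff, mem_iUnion]
    exact ⟨by rintro ⟨rfl, _, rfl, hx⟩; exact hx, fun hx => ⟨hAp k hx, k, hAp k hx, hx⟩⟩
  refine ⟨⋃ k, p ⁻¹' {k} ∩ A k, ⟨⟨?_⟩, hopen _ fun k => (hA k).isOpen⟩, fun k => ?_⟩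
  · convert hopen (fun k => (A k)ᶜ) fun k => (hA k).compl.isOpen
    ext x
    simp
  · obtain ⟨m, rfl | rfl⟩ := Nat.even_or_odd' k
    · rw [preimage_refineLabel_even, preimage_refineLabel_even, ← sdiff_inter_self_eq_sdiff,
        inter_comm, hinter, ← sdiff_inter_self_eq_sdiff (t := B), inter_comm B,
        measure_sdiff (hAp m) (hA m).isOpen.measurableSet.nullMeasurableSet (measure_ne_top _ _),
        measure_sdiff inter_subset_left ((hqk m).inter hB).isOpen.measurableSet.nullMeasurableSet
          (measure_ne_top _ _), hAm, h m]
    · rw [preimage_refineLabel_odd, preimage_refineLabel_odd, hinter, hAm]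

/-- Matched labellings of good Cantor measure spaces with the same clopen values are intertwined
by a continuous measure-preserving map. -/
theorem IsGoodCantorMeasureSpace.exists_map_of_matched {X Y : Type*} [TopologicalSpace X]
    [MeasurableSpace X] [TopologicalSpace Y] [MeasurableSpace Y] {μ : Measure X} {ν : Measure Y}
    (hμ : IsGoodCantorMeasureSpace X μ) (hν : IsGoodCantorMeasureSpace Y ν)
    (hS : clopenValues ν ⊆ clopenValues μ) {p : X → ℕ} {q : Y → ℕ} (hp : Continuous p)
    (hq : Continuous q) (h : MeasureMatched μ ν p q) :
    ∃ g : CantorMeasureMap μ ν, ∀ x, q (g.1 x) = p x := by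
  have := hμ.borel
  have := hν.borel
  have := hν.cantor.compact
  have := hν.cantor.metrizable
  have := hν.cantor.clopen_basis.countable_clopens
  obtain ⟨e, he⟩ := exists_surjective_nat (Clopens Y)
  -- The parity of `Q (n + 1)` decides membership in `e n`, so the labellings `Q n` together
  -- determine every clopen set.
  let Q : ℕ → Y → ℕ := fun n => Nat.rec q (fun n r => refineLabel r (e n)) n
  have hQs (n : ℕ) : Q (n + 1) = refineLabel (Q n) (e n) := rfl
  have hQc (n : ℕ) : Continuous (Q n) := by
    induction n with
    | zero => exact hq
    | succ n ih => exact continuous_refineLabel ih (e n).isClopen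
  have step (n : ℕ) (r : {r : X → ℕ // Continuous r ∧ MeasureMatched μ ν r (Q n)}) :
      ∃ r' : {r : X → ℕ // Continuous r ∧ MeasureMatched μ ν r (Q (n + 1))},
        ∀ x, r'.1 x / 2 = r.1 x := by
    obtain ⟨A, hA, hm⟩ := hμ.exists_refineLabel hν hS r.2.1 (hQc n) r.2.2 (e n).isClopen
    exact ⟨⟨_, continuous_refineLabel r.2.1 hA, hm⟩, refineLabel_div _ _⟩
  choose F hF using step
  let P : ∀ n, {r : X → ℕ // Continuous r ∧ MeasureMatched μ ν r (Q n)} :=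
    fun n => Nat.rec ⟨p, hp, h⟩ F n
  have hPs (n : ℕ) (x : X) : (P (n + 1)).1 x / 2 = (P n).1 x := hF n (P n) x
  -- These cells are nested and compact. Each is nonempty since its measure is that of an open set
  -- containing `x`, positive by fullness.
  have hlim (x : X) : (⋂ n, Q n ⁻¹' {(P n).1 x}).Nonempty := by
    refine IsCompact.nonempty_iInter_of_sequence_nonempty_isCompact_isClosed _ (fun n y hy => ?_)
      (fun n => ?_) ((isClosed_discrete _).preimage (hQc 0)).isCompact
      (fun n => (isClosed_discrete _).preimage (hQc n))
    · simp only [mem_preimage, mem_singleton_iff] at hy ⊢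
      rw [← hPs, ← hy, hQs, refineLabel_div]
    · apply nonempty_of_measure_ne_zero (μ := ν)
      rw [← (P n).2.2]
      exact (hμ.full _ ((isOpen_discrete {(P n).1 x}).preimage (P n).2.1) ⟨x, rfl⟩).ne'
  choose g hg using hlim
  have hg' (n : ℕ) (x : X) : Q n (g x) = (P n).1 x := mem_iInter.1 (hg x) n
  have hpre (n : ℕ) : g ⁻¹' (e n : Set Y) = (P (n + 1)).1 ⁻¹' {k | k % 2 = 1} := by
    ext x
    rw [mem_preimage, mem_preimage, mem_ofPred_eq, ← hg' (n + 1) x, hQs, refineLabel_mod]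
  have hpreQ (n : ℕ) : (e n : Set Y) = Q (n + 1) ⁻¹' {k | k % 2 = 1} := by
    ext x
    rw [mem_preimage, mem_ofPred_eq, hQs, refineLabel_mod]
  have hgc : Continuous g := by
    refine hν.cantor.clopen_basis.continuous_iff.2 fun B hB => ?_
    obtain ⟨n, hn⟩ := he ⟨B, hB⟩
    have : B = e n := by rw [hn]; rfl
    rw [this, hpre]
    exact (isOpen_discrete {k | k % 2 = 1}).preimage (P (n + 1)).2.1
  refine ⟨⟨⟨g, hgc⟩, hμ.measurePreserving_of_clopen hν.toIsCantorMeasureSpace hgc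
    fun B hB => ?_⟩, hg' 0⟩
  obtain ⟨n, hn⟩ := he ⟨B, hB⟩
  have : B = e n := by rw [hn]; rfl
  rw [this, ContinuousMap.coe_mk, hpre, hpreQ]
  exact (P (n + 1)).2.2.preimage_eq (P (n + 1)).2.1 (hQc (n + 1)) _

/-- A compact metric space with a basis of clopen sets has a finite clopen partition of small mesh,
here given as a labelling. -/
theorem exists_continuous_nat_dist_lt {Y : Type*} [MetricSpace Y] [CompactSpace Y]
    (hb : IsTopologicalBasis {U : Set Y | IsClopen U}) {ε : ℝ} (hε : 0 < ε) :
    ∃ q : Y → ℕ, Continuous q ∧ ∀ y z, q y = q z → dist y z < ε := by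
  have := hb.countable_clopens
  obtain ⟨e, he⟩ := exists_surjective_nat (Clopens Y)
  have hex (y : Y) : ∃ n, y ∈ e n ∧ ∀ z ∈ e n, ∀ w ∈ e n, dist z w < ε := by
    obtain ⟨U, hU, hy, hUb⟩ := hb.mem_nhds_iff.1 (Metric.ball_mem_nhds y (half_pos hε))
    obtain ⟨n, hn⟩ := he ⟨U, hU⟩
    have hn' : (e n : Set Y) = U := by rw [hn]; rfl
    refine ⟨n, (hn' ▸ hy : y ∈ (e n : Set Y)), fun z hz w hw => ?_⟩
    have hz' : dist z y < ε / 2 := hUb (hn' ▸ hz)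
    have hw' : dist w y < ε / 2 := hUb (hn' ▸ hw)
    linarith [dist_triangle_right z w y]
  classical
  -- The label of `y` is the index of the first small clopen set containing it.
  refine ⟨fun y => Nat.find (hex y), continuous_discrete_rng.2 fun n => ?_, fun y z hyz => ?_⟩
  · by_cases hn : ∀ z ∈ e n, ∀ w ∈ e n, dist z w < ε
    · have : (fun y => Nat.find (hex y)) ⁻¹' {n} = (e n : Set Y) ∩
          ⋂ m ∈ {m | m < n ∧ ∀ z ∈ e m, ∀ w ∈ e m, dist z w < ε}, (e m : Set Y)ᶜ := by
        ext y
        simp only [mem_preimage, mem_singleton_iff, Nat.find_eq_iff, mem_inter_iff, mem_iInter,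
          mem_ofPred_eq, mem_compl_iff, SetLike.mem_coe]
        exact ⟨fun h => ⟨h.1.1, fun m hm hy => h.2 m hm.1 ⟨hy, hm.2⟩⟩,
          fun h => ⟨⟨h.1, hn⟩, fun m hm hy => h.2 m ⟨hm, hy.2⟩ hy.1⟩⟩
      rw [this]
      exact (e n).isClopen.isOpen.inter (((finite_lt_nat n).subset fun m hm => hm.1).isOpen_biInter
        fun m _ => (e m).isClopen.compl.isOpen)
    · convert isOpen_empty
      exact eq_empty_of_forall_notMem fun y (hy : Nat.find (hex y) = n) =>
        hn (hy ▸ (Nat.find_spec (hex y)).2)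
  · exact (Nat.find_spec (hex y)).2 y (Nat.find_spec (hex y)).1 z
      (by rw [show Nat.find (hex y) = Nat.find (hex z) from hyz]; exact (Nat.find_spec (hex z)).1)

/-! ### Closedness of the space of maps, and isomorphisms as injective maps. -/

/-- For clopen `B`, the set `f ⁻¹' B` is locally constant in `f`, and clopen sets suffice to test
measure preservation. -/
theorem CantorMeasureMap.isClosed_setOf_measurePreserving {X Y : Type*} [TopologicalSpace X]
    [MeasurableSpace X] [TopologicalSpace Y] [MeasurableSpace Y] {μ : Measure X} {ν : Measure Y}
    (hμ : IsCantorMeasureSpace X μ) (hν : IsCantorMeasureSpace Y ν) :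
    IsClosed {f : C(X, Y) | MeasurePreserving f μ ν} := by
  have := hμ.cantor.compact
  have : {f : C(X, Y) | MeasurePreserving f μ ν} =
      ⋂ (B : Set Y) (_ : IsClopen B), {f : C(X, Y) | μ (f ⁻¹' B) = ν B} := by
    have := hν.borel
    ext f
    simp only [mem_ofPred_eq, mem_iInter]
    exact ⟨fun hf B hB => hf.measure_preimage hB.isOpen.measurableSet.nullMeasurableSet,
      fun hf => hμ.measurePreserving_of_clopen hν f.continuous hf⟩
  rw [this]
  refine isClosed_iInter fun B => isClosed_iInter fun hB => ?_
  rw [← isOpen_compl_iff, isOpen_iff_mem_nhds]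
  intro f hf
  have h₁ := ContinuousMap.isOpen_setOfPred_mapsTo (hB.preimage f.continuous).isClosed.isCompact
    hB.isOpen
  have h₂ := ContinuousMap.isOpen_setOfPred_mapsTo 
    (hB.preimage f.continuous).compl.isClosed.isCompact
    hB.compl.isOpen
  filter_upwards [h₁.mem_nhds (mapsTo_preimage f B), h₂.mem_nhds (mapsTo_preimage f Bᶜ)]
    with g hg₁ hg₂
  have : g ⁻¹' B = f ⁻¹' B :=
    Subset.antisymm (fun x hx => by_contra fun hx' => hg₂ hx' hx) hg₁
  rwa [mem_compl_iff, mem_ofPred_eq, this]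

/-- The range is compact, so its complement is open; that complement is null, hence empty by
fullness. -/
theorem CantorMeasureMap.isIsomorphism_and_isHomeomorph {X Y : Type*} [TopologicalSpace X]
    [MeasurableSpace X] [TopologicalSpace Y] [MeasurableSpace Y] {μ : Measure X} {ν : Measure Y}
    (hμ : IsCantorMeasureSpace X μ) (hν : IsCantorMeasureSpace Y ν) {f : CantorMeasureMap μ ν}
    (hf : Function.Injective f.1) : f.IsIsomorphism ∧ IsHomeomorph f.1 := by
  have := hμ.cantor.compact
  have := hν.cantor.metrizable
  have := hμ.borel
  have := hν.borel
  have hsurj : Function.Surjective f.1 := by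
    have hcl : IsClosed (range f.1) := (isCompact_range f.1.continuous).isClosed
    rw [← range_eq_univ]
    by_contra hne
    refine (hν.full _ hcl.isOpen_compl (nonempty_compl.2 hne)).ne' ?_
    rw [← f.2.measure_preimage hcl.isOpen_compl.measurableSet.nullMeasurableSet]
    simp
  have hhom : IsHomeomorph f.1 :=
    isHomeomorph_iff_continuous_bijective.2 ⟨f.1.continuous, hf, hsurj⟩
  let e := hhom.homeomorph
  have he (x : X) : e x = f.1 x := rfl
  have hg : MeasurePreserving e.symm ν μ :=
    MeasurePreserving.symm e.toMeasurableEquiv f.2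
  exact ⟨⟨⟨⟨e.symm, e.symm.continuous⟩, hg⟩,
    .of_forall fun x => e.symm_apply_apply x, .of_forall fun y => e.apply_symm_apply y⟩, hhom⟩

theorem CantorMeasureMap.IsIsomorphism.injective {X Y : Type*} [TopologicalSpace X]
    [MeasurableSpace X] [TopologicalSpace Y] [MeasurableSpace Y] {μ : Measure X} {ν : Measure Y}
    (hμ : IsCantorMeasureSpace X μ) {f : CantorMeasureMap μ ν} (hf : f.IsIsomorphism) :
    Function.Injective f.1 := by
  have := hμ.cantor.metrizable
  obtain ⟨g, hgf, -⟩ := hf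
  refine Function.LeftInverse.injective (g := g.1) fun x => ?_
  by_contra hx
  have ho : IsOpen {x | g.1 (f.1 x) ≠ x} :=
    isOpen_ne_fun (g.1.continuous.comp f.1.continuous) continuous_id
  exact (hμ.full _ ho ⟨x, hx⟩).ne' (ae_iff.1 hgf)

/-! ### Openness and density of the separation conditions. -/

theorem ContinuousMap.isOpen_setOf_disjoint_image {X Y : Type*} [TopologicalSpace X]
    [TopologicalSpace Y] [T2Space Y] {K L : Set X} (hK : IsCompact K) (hL : IsCompact L) :
    IsOpen {f : C(X, Y) | Disjoint (f '' K) (f '' L)} := by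
  rw [isOpen_iff_mem_nhds]
  intro f hf
  obtain ⟨U, V, hU, hV, hKU, hLV, hUV⟩ :=
    SeparatedNhds.of_isCompact_isCompact (hK.image f.continuous) (hL.image f.continuous) hf
  filter_upwards [(ContinuousMap.isOpen_setOfPred_mapsTo hK hU).mem_nhds
      (mapsTo_iff_image_subset.2 hKU),
    (ContinuousMap.isOpen_setOfPred_mapsTo hL hV).mem_nhds
      (mapsTo_iff_image_subset.2 hLV)] with g h₁ h₂
  exact hUV.mono h₁.image_subset h₂.image_subset

theorem CantorMeasureMap.dense_setOf_disjoint_image {X Y : Type*} [TopologicalSpace X]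
    [MeasurableSpace X] [TopologicalSpace Y] [MeasurableSpace Y] {μ : Measure X} {ν : Measure Y}
    (hμ : IsGoodCantorMeasureSpace X μ) (hν : IsGoodCantorMeasureSpace Y ν)
    (hS : clopenValues μ = clopenValues ν) {A : Set X} (hA : IsClopen A) :
    Dense {f : CantorMeasureMap μ ν | Disjoint (f.1 '' A) (f.1 '' Aᶜ)} := by
  have := hν.borel
  have := hμ.cantor.compact
  have := hν.cantor.compact
  have := hν.cantor.metrizable
  let := metrizableSpaceMetric Y
  refine Metric.dense_iff.2 fun f ε hε => ?_
  -- Mesh `ε / 2`, because `ContinuousMap.dist_le` gives only a non-strict bound.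
  obtain ⟨q, hq, hqε⟩ := exists_continuous_nat_dist_lt hν.cantor.clopen_basis (half_pos hε)
  have hqf : Continuous (q ∘ f.1) := hq.comp f.1.continuous
  have hm : MeasureMatched ν μ q (q ∘ f.1) := fun k =>
    (f.2.measure_preimage ((isOpen_discrete {k}).preimage hq).measurableSet.nullMeasurableSet).symm
  -- Roles reversed: the splitting by `A` is copied from `X` to `Y`.
  obtain ⟨B, hB, hBm⟩ := hν.exists_refineLabel hμ hS.le hq hqf hm hA
  obtain ⟨g, hg⟩ := hμ.exists_map_of_matched hν hS.ge (continuous_refineLabel hqf hA)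
    (continuous_refineLabel hq hB) fun k => (hBm k).symm
  refine ⟨g, ?_, ?_⟩
  · refine lt_of_le_of_lt ((ContinuousMap.dist_le (half_pos hε).le).2 fun x => ?_) (half_lt_self hε)
    refine (hqε _ _ ?_).le
    rw [← refineLabel_div q B, hg, refineLabel_div, Function.comp_apply]
  · have hgA (x : X) : g.1 x ∈ B ↔ x ∈ A := by
      rw [← refineLabel_mod q B, hg, refineLabel_mod]
    rw [mem_ofPred_eq, Set.disjoint_left]
    rintro _ ⟨x, hx, rfl⟩ ⟨z, hz, hxz⟩
    exact hz ((hgA z).1 (hxz ▸ (hgA x).2 hx))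

theorem IsCantorSpace.injective_iff_disjoint_image {X Y : Type*} [TopologicalSpace X]
    (hX : IsCantorSpace X) {f : X → Y} :
    Function.Injective f ↔ ∀ A : Clopens X, Disjoint (f '' A) (f '' (A : Set X)ᶜ) := by
  have := hX.metrizable
  refine ⟨fun hf A => (disjoint_image_iff hf).2 disjoint_compl_right, fun h x z hxz => ?_⟩
  by_contra hne
  obtain ⟨U, hU, hx, hUz⟩ :=
    hX.clopen_basis.mem_nhds_iff.1 (isOpen_compl_singleton.mem_nhds (mem_compl_singleton_iff.2 hne))
  exact Set.disjoint_left.1 (h ⟨U, hU⟩) (mem_image_of_mem f hx)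
    ⟨z, fun hz => hUz hz rfl, hxz.symm⟩

theorem theorem4p09 {X Y : Type*} [TopologicalSpace X] [MeasurableSpace X]
    [TopologicalSpace Y] [MeasurableSpace Y] (μ : Measure X) (ν : Measure Y)
    (hμ : IsGoodCantorMeasureSpace X μ) (hν : IsGoodCantorMeasureSpace Y ν)
    (hS : clopenValues μ = clopenValues ν) :
    IsCompletelyMetrizableSpace (CantorMeasureMap μ ν) ∧
      IsGδ {f : CantorMeasureMap μ ν | CantorMeasureMap.IsIsomorphism f} ∧
      Dense {f : CantorMeasureMap μ ν | CantorMeasureMap.IsIsomorphism f} ∧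
      ∀ᶠ f in residual (CantorMeasureMap μ ν),
        CantorMeasureMap.IsIsomorphism f ∧ IsHomeomorph f.1 := by
  have := hμ.cantor.compact
  have := hν.cantor.compact
  have := hμ.cantor.metrizable
  have := hν.cantor.metrizable
  let := metrizableSpaceMetric Y
  have := hμ.cantor.clopen_basis.countable_clopens
  have : CompleteSpace (CantorMeasureMap μ ν) :=
    (CantorMeasureMap.isClosed_setOf_measurePreserving hμ.toIsCantorMeasureSpace
      hν.toIsCantorMeasureSpace).completeSpace_coe
  have hiso {f : CantorMeasureMap μ ν} : f.IsIsomorphism ↔ Function.Injective f.1 :=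
    ⟨fun h => h.injective hμ.toIsCantorMeasureSpace, fun h =>
      (CantorMeasureMap.isIsomorphism_and_isHomeomorph hμ.toIsCantorMeasureSpace
        hν.toIsCantorMeasureSpace h).1⟩
  have hset : {f : CantorMeasureMap μ ν | CantorMeasureMap.IsIsomorphism f} =
      ⋂ A : Clopens X, {f : CantorMeasureMap μ ν | Disjoint (f.1 '' A) (f.1 '' (A : Set X)ᶜ)} := by
    ext f
    rw [mem_ofPred_eq, hiso, hμ.cantor.injective_iff_disjoint_image, mem_iInter]
    rfl
  have hopen (A : Clopens X) :
      IsOpen {f : CantorMeasureMap μ ν | Disjoint (f.1 '' A) (f.1 '' (A : Set X)ᶜ)} :=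
    (ContinuousMap.isOpen_setOf_disjoint_image A.isClopen.isClosed.isCompact
      A.isClopen.compl.isClosed.isCompact).preimage continuous_subtype_val
  have hGδ : IsGδ {f : CantorMeasureMap μ ν | CantorMeasureMap.IsIsomorphism f} := by
    rw [hset]
    exact IsGδ.iInter_of_isOpen hopen
  have hdense : Dense {f : CantorMeasureMap μ ν | CantorMeasureMap.IsIsomorphism f} := by
    rw [hset]
    exact dense_iInter_of_isOpen hopen fun A =>
      CantorMeasureMap.dense_setOf_disjoint_image hμ hν hS A.isClopen
  refine ⟨inferInstance, hGδ, hdense, ?_⟩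
  filter_upwards [residual_of_dense_Gδ hGδ hdense] with f hf
  exact CantorMeasureMap.isIsomorphism_and_isHomeomorph hμ.toIsCantorMeasureSpace
    hν.toIsCantorMeasureSpace (hiso.1 hf)
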